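/- **Setting.** A Markov decision model consists of Borel spaces $\mathcal S$ (states) and $\mathcal U$ (actions), i.e. Borel subsets of complete separable metric spaces, nonempty measurable sets $\mathcal U(s)\subseteq\mathcal U$ of feasible actions such that $\mathbb K=\{(s,u): s\in\mathcal S,\ u\in\mathcal U(s)\}$ is measurable, a stochastic kernel $Q$ on $\mathcal S$ given $\mathbb K$, and a measurable reward $r:\mathbb K\to\mathbb R$. Let $\alpha\in[0,1)$. For a randomized history-dependent policy $\pi$ (choosing feasible actions) let $V(\pi,s)=\mathbb E_s^\pi\big[\sum_{t\ge0}\alpha^t r(s_t,u_t)\big]$, and let $V^*(s)=\sup_\pi V(\pi,s)$. The discounted optimality equations are $$V^*(s)=\sup_{u\in\mathcal U(s)}\Big\{r(s,u)+\alpha\int_{\mathcal S}V^*(s')\,Q(ds'|s,u)\Big\},\qquad s\in\mathcal S.\tag{DCOE}$$ Let $A^*(s)\subseteq\mathcal U(s)$ be the set of maximizers in (DCOE) at $s$. An optimal selector is a measurable $f^*:\mathcal S\to\mathcal U$ with $f^*(s)\in A^*(s)$ for all $s$. Let $\Phi$ be the set of stochastic kernels $\varphi$ on $\mathcal U$ given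 $\mathcal S$ with $\varphi(\mathcal U(s)|s)=1$ for all $s$. For a probability measure $\nu$ on $\mathcal S$ and $\varphi\in\Phi$ put $$\overline r(\nu,\varphi)=\int_{\mathcal S}\int_{\mathcal U}r(s,u)\,\varphi(du|s)\,d\nu(s),\qquad F(\nu,\varphi)(\cdot)=\int_{\mathcal S}\int_{\mathcal U}Q(\cdot|s,u)\,\varphi(du|s)\,d\nu(s),$$ and $\overline V^*(\nu)=\sup\big\{\sum_{t\ge0}\alpha^t\,\overline r(\nu_t,\varphi_t):\ \varphi_t\in\Phi,\ \nu_0=\nu,\ \nu_{t+1}=F(\nu_t,\varphi_t)\big\}$. The measurized discounted optimality equations are $$\overline V^*(\nu)=\sup_{\varphi\in\Phi}\big\{\overline r(\nu,\varphi)+\alpha\,\overline V^*(F(\nu,\varphi))\big\}\qquad\text{for all probability measures }\nu\text{ on }\mathcal S.\tag{$\mathcal M$-DCOE}$$ A rule $\varphi\in\Phi$ is called optimal at $\nu$ if it attains this supremum at $\nu$. **Assumptions.** (i) $r$ is upper semicontinuous, bounded above and bounded below on $\mathbb K$, and $\{u\in\mathcal U(s): r(s,u)\ge c\}$ is compact for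 all $s\in\mathcal S$, $c\in\mathbb R$. (ii) $Q$ is strongly continuous: $(s,u)\mapsto\int g(s')\,Q(ds'|s,u)$ is continuous on $\mathbb K$ for every bounded measurable $g$. (iii) There is a policy with finite value from every initial state. (iv) $\{(s,u)\in\mathbb K: s\in\mathcal C\}$ is compact for every compact $\mathcal C\subseteq\mathcal S$. **Theorem.** Under these assumptions (DCOE) and ($\mathcal M$-DCOE) hold, an optimal selector $f^*$ exists, and: 1. For every optimal selector $f^*$, the Dirac kernel $\varphi^*\in\Phi$ with $\varphi^*(\{f^*(s)\}|s)=1$ for all $s\in\mathcal S$, which does not depend on $\nu$, is optimal at every $\nu$. 2. Conversely, $\varphi\in\Phi$ is optimal at a given $\nu$ if and only if $\varphi(A^*(s)|s)=1$ for $\nu$-almost every $s$, and it is optimal at every $\nu$ if and only if $\varphi(A^*(s)|s)=1$ for all $s\in\mathcal S$. In particular, if the optimal selector $f^*$ is unique, then every $\varphi\in\Phi$ that is optimal at every $\nu$ satisfies $\varphi(\{f^*(s)\}|s)=1$ for all $s\in\mathcal S$. -/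

import Mathlib

open MeasureTheory ProbabilityTheory Set

/-- A Markov decision model with state space `S` and action space `U`: nonempty sets of feasible
actions with measurable graph `K`, a stochastic kernel `Q` on `S` given `K`, and a measurable
reward function on `K`. -/
structure MDP (S U : Type*) [MeasurableSpace S] [MeasurableSpace U] where
  /-- the set of feasible actions in each state -/
  feasible : S → Set U
  feasible_nonempty : ∀ s, (feasible s).Nonempty
  measurableSet_graph : MeasurableSet {p : S × U | p.2 ∈ feasible p.1}
  /-- the transition law, given feasible state-action pairs only -/
  Q : Kernel ↥{p : S × U | p.2 ∈ feasible p.1} S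
  markov_Q : IsMarkovKernel Q
  /-- the reward per stage, on feasible state-action pairs only -/
  r : ↥{p : S × U | p.2 ∈ feasible p.1} → ℝ
  measurable_r : Measurable r

namespace MDP

variable {S U : Type*} [MeasurableSpace S] [MeasurableSpace U] (M : MDP S U)

/-- The space of feasible state-action pairs. -/
abbrev K : Type _ := ↥{p : S × U | p.2 ∈ M.feasible p.1}

instance : IsMarkovKernel M.Q := M.markov_Q

/-- The feasible pair made of the state `s` and the feasible action `u`. -/
def pair (s : S) (u : M.feasible s) : M.K := ⟨(s, u.1), u.2⟩

/-- If an action is drawn from `κ (· | x)` while the current state is `σ x`, then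
`pairKernel σ κ (· | x)` is the law of the state-action pair: the product of the Dirac measure at
`σ x` and `κ (· | x)`, seen as a measure on the feasible pairs. -/
noncomputable def pairKernel {X : Type*} [MeasurableSpace X] (σ : X → S) (hσ : Measurable σ)
    (κ : Kernel X U) : Kernel X M.K :=
  (Kernel.deterministic σ hσ ×ₖ κ).comapRight
    (MeasurableEmbedding.subtype_coe M.measurableSet_graph)

lemma isMarkovKernel_pairKernel {X : Type*} [MeasurableSpace X] (σ : X → S) (hσ : Measurable σ)
    (κ : Kernel X U) [IsMarkovKernel κ] (hκ : ∀ x, κ x (M.feasible (σ x)) = 1) :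
    IsMarkovKernel (M.pairKernel σ hσ κ) := by
  refine Kernel.IsMarkovKernel.comapRight _ _ fun x => ?_
  rw [Subtype.range_coe, Kernel.prod_apply, Kernel.deterministic_apply,
    Measure.dirac_prod, Measure.map_apply measurable_prodMk_left M.measurableSet_graph]
  exact hκ x

/-! ### Policies and the value function of the original problem -/

/-- A randomized, history dependent policy: for every `t` a stochastic kernel on the actions given
the admissible history `(s₀, u₀, …, s_{t-1}, u_{t-1}, s_t)`, concentrated on the actions that are
feasible in the current state `s_t`. -/
structure Policy where
  toKernel : (t : ℕ) → Kernel ((Fin t → M.K) × S) U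
  markov : ∀ t, IsMarkovKernel (toKernel t)
  feasible : ∀ t h, toKernel t h (M.feasible h.2) = 1

variable {M}

/-- The law of `(s_t, u_t)` given the past pairs and the current state `s_t`. -/
noncomputable def Policy.pairLaw (π : M.Policy) (t : ℕ) : Kernel ((Fin t → M.K) × S) M.K :=
  M.pairKernel Prod.snd measurable_snd (π.toKernel t)

instance (π : M.Policy) (t : ℕ) : IsMarkovKernel (π.pairLaw t) :=
  haveI := π.markov t
  M.isMarkovKernel_pairKernel _ _ _ (π.feasible t)

/-- The law of `s_{t+1}`, together with the past pairs, given the pairs up to time `t`. -/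
noncomputable def historyStep (M : MDP S U) (t : ℕ) :
    Kernel ((i : Finset.Iic t) → M.K) ((Fin (t + 1) → M.K) × S) :=
  Kernel.deterministic
      (fun (h : (i : Finset.Iic t) → M.K) (i : Fin (t + 1)) =>
        h ⟨i, Finset.mem_Iic.2 (Nat.lt_succ_iff.1 i.2)⟩)
      (measurable_pi_lambda _ fun _ => measurable_pi_apply _) ×ₖ
    M.Q.comap (fun h => h ⟨t, Finset.mem_Iic.2 le_rfl⟩) (measurable_pi_apply _)

instance (t : ℕ) : IsMarkovKernel (M.historyStep t) := by
  unfold historyStep; infer_instance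

/-- The law of `(s_{t+1}, u_{t+1})` given the pairs up to time `t`: first `s_{t+1}` is drawn from
`Q (· | s_t, u_t)`, then `u_{t+1}` from the policy. -/
noncomputable def Policy.step (π : M.Policy) (t : ℕ) :
    Kernel ((i : Finset.Iic t) → M.K) M.K :=
  π.pairLaw (t + 1) ∘ₖ M.historyStep t

instance (π : M.Policy) (t : ℕ) : IsMarkovKernel (π.step t) := by
  unfold Policy.step; infer_instance

/-- The law of `(s₀, u₀)` when `s₀` has law `ν`. -/
noncomputable def Policy.initialLaw (π : M.Policy) (ν : Measure S) : Measure M.K :=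
  (ν.map fun s => ((fun i => i.elim0 : Fin 0 → M.K), s)).bind (π.pairLaw 0)

/-- The Ionescu-Tulcea law of the whole process `(s_t, u_t)_{t ≥ 0}` with initial law `ν` under the
policy `π`, on the space of infinite admissible histories. -/
noncomputable def Policy.law (π : M.Policy) (ν : Measure S) : Measure (ℕ → M.K) :=
  Kernel.trajMeasure (X := fun _ => M.K) (π.initialLaw ν) π.step

/-- The discounted total reward along an admissible history. -/
noncomputable def totalReward (M : MDP S U) (α : ℝ) (ω : ℕ → M.K) : ℝ :=
  ∑' t, α ^ t * M.r (ω t)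

/-- The value `V(π, s)` of the policy `π` from the initial state `s`. -/
noncomputable def Policy.value (π : M.Policy) (α : ℝ) (s : S) : ℝ :=
  ∫ ω, M.totalReward α ω ∂(π.law (Measure.dirac s))

/-- The optimal value function `V*`. -/
noncomputable def optValue (M : MDP S U) (α : ℝ) (s : S) : ℝ :=
  ⨆ π : M.Policy, π.value α s

/-! ### Optimality equations of the original problem -/

/-- The expression `r(s,u) + α 𝔼_Q[V(s') | s,u]`. -/
noncomputable def qValue (M : MDP S U) (α : ℝ) (V : S → ℝ) (k : M.K) : ℝ :=
  M.r k + α * ∫ s', V s' ∂(M.Q k)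

/-- `V` solves the discounted optimality equations
`V(s) = sup_{u ∈ U(s)} (r(s,u) + α 𝔼_Q[V(s') | s,u])` for all `s`. -/
def SolvesDCOE (M : MDP S U) (α : ℝ) (V : S → ℝ) : Prop :=
  ∀ s, IsLUB (range fun u : M.feasible s => M.qValue α V (M.pair s u)) (V s)

/-- The feasible actions that attain the maximum in the optimality equation at `s`. -/
def maximizers (M : MDP S U) (α : ℝ) (V : S → ℝ) (s : S) : Set U :=
  {u | ∃ hu : u ∈ M.feasible s, ∀ u' : M.feasible s,
    M.qValue α V (M.pair s u') ≤ M.qValue α V (M.pair s ⟨u, hu⟩)}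

/-- `f` is a (measurable) selector, i.e. `f(s)` is feasible in every state `s`. -/
def IsSelector (M : MDP S U) (f : S → U) : Prop :=
  Measurable f ∧ ∀ s, f s ∈ M.feasible s

/-- `f` is an optimal selector: a selector attaining, in every state, the maximum in the optimality
equations for the optimal value function. -/
def IsOptimalSelector (M : MDP S U) (α : ℝ) (f : S → U) : Prop :=
  M.IsSelector f ∧ ∀ s, f s ∈ M.maximizers α (M.optValue α) s

/-! ### The measurized counterpart -/

/-- The set `Φ` of Markov decision rules: stochastic kernels `φ` on `U` given `S` with
`φ(U(s) | s) = 1` for all `s`. -/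
structure DecisionRule (M : MDP S U) where
  toKernel : Kernel S U
  markov : IsMarkovKernel toKernel
  feasible : ∀ s, toKernel s (M.feasible s) = 1

/-- The law of the state-action pair given the state, under a decision rule. -/
noncomputable def DecisionRule.pairLaw (φ : M.DecisionRule) : Kernel S M.K :=
  M.pairKernel id measurable_id φ.toKernel

instance (φ : M.DecisionRule) : IsMarkovKernel φ.pairLaw :=
  haveI := φ.markov
  M.isMarkovKernel_pairKernel _ _ _ φ.feasible

/-- The measurized reward `∫_S ∫_U r(s,u) φ(du|s) dν(s)`. -/
noncomputable def liftedReward (M : MDP S U) (ν : ProbabilityMeasure S) (φ : M.DecisionRule) : ℝ :=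
  ∫ s, ∫ k, M.r k ∂(φ.pairLaw s) ∂(ν : Measure S)

/-- The deterministic transition `F(ν,φ)(·) = ∫_S ∫_U Q(·|s,u) φ(du|s) dν(s)`. -/
noncomputable def liftedStep (M : MDP S U) (ν : ProbabilityMeasure S) (φ : M.DecisionRule) :
    ProbabilityMeasure S :=
  ⟨(ν : Measure S).bind (M.Q ∘ₖ φ.pairLaw), inferInstance⟩

/-- The path of state distributions `ν₀ = ν`, `ν_{t+1} = F(ν_t, φ_t)`. -/
noncomputable def liftedPath (M : MDP S U) (ν : ProbabilityMeasure S) (φ : ℕ → M.DecisionRule) :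
    ℕ → ProbabilityMeasure S
  | 0 => ν
  | t + 1 => M.liftedStep (M.liftedPath ν φ t) (φ t)

/-- The optimal measurized value function: the supremum over all sequences of decision rules of
`∑_t α^t r̄(ν_t, φ_t)` along the path started at `ν`. -/
noncomputable def liftedOptValue (M : MDP S U) (α : ℝ) (ν : ProbabilityMeasure S) : ℝ :=
  ⨆ φ : ℕ → M.DecisionRule, ∑' t, α ^ t * M.liftedReward (M.liftedPath ν φ t) (φ t)

/-- The expression `r̄(ν,φ) + α W(F(ν,φ))`. -/
noncomputable def liftedQValue (M : MDP S U) (α : ℝ) (W : ProbabilityMeasure S → ℝ)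
    (ν : ProbabilityMeasure S) (φ : M.DecisionRule) : ℝ :=
  M.liftedReward ν φ + α * W (M.liftedStep ν φ)

/-- `W` solves the measurized discounted optimality equations
`W(ν) = sup_{φ ∈ Φ} (r̄(ν,φ) + α W(F(ν,φ)))` for all `ν`. -/
def SolvesLiftedDCOE (M : MDP S U) (α : ℝ) (W : ProbabilityMeasure S → ℝ) : Prop :=
  ∀ ν, IsLUB (range (M.liftedQValue α W ν)) (W ν)

/-- The decision rule `φ` attains the maximum in the measurized optimality equation at `ν`, for the
optimal measurized value function. -/
def IsOptimalRuleAt (M : MDP S U) (α : ℝ) (ν : ProbabilityMeasure S) (φ : M.DecisionRule) : Prop :=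
  ∀ φ' : M.DecisionRule,
    M.liftedQValue α (M.liftedOptValue α) ν φ' ≤ M.liftedQValue α (M.liftedOptValue α) ν φ

/-! ### Standing assumptions -/

/-- For every state `s` and every real `c`, the set `{u ∈ U(s) : r(s,u) ≥ c}` is compact. -/
def SupCompact [TopologicalSpace U] (M : MDP S U) : Prop :=
  ∀ (s : S) (c : ℝ), IsCompact {u : U | ∃ hu : u ∈ M.feasible s, c ≤ M.r (M.pair s ⟨u, hu⟩)}

/-- `Q` is strongly continuous: `(s,u) ↦ ∫ g(s') Q(ds'|s,u)` is continuous (and then bounded) on the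
feasible pairs for every bounded measurable `g`. -/
def StronglyContinuous [TopologicalSpace S] [TopologicalSpace U] (M : MDP S U) : Prop :=
  ∀ g : S → ℝ, Measurable g → (∃ C, ∀ s, |g s| ≤ C) → Continuous fun k : M.K => ∫ s', g s' ∂(M.Q k)

end MDP

/-! The heart is one bounded measurable `V` solving the optimality equation with attained maxima,
together with a measurable selector of maximizers. Compactness of the feasible pairs over compact
sets makes the projection of `M.K` to the states proper, so closed sets of pairs have closed, hence
Borel, projections. Upper semicontinuity and strong continuity then let the Bellman operator
preserve bounded measurable functions, and a contraction argument yields `V`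
(`exists_bellman_fixedPoint`). The selector comes from `exists_measurable_argmax`.

Both control problems produce a sequence of laws of state-action pairs linked by `Q`, a flow in the
sense of `IsFlow`. Integrating `qValue ≤ V` and telescoping (`IsFlow.tsum_reward`) bounds the
discounted reward of any flow by the integral of `V` against its initial state law, with equality
when every pair law lives on maximizing pairs. Hence the original value is `V`, and the measurized
value is the linear functional `ν ↦ ∫ V dν`.

By this linearity the measurized objective is the integral of `qValue` against the joint law of
state and action. Since `qValue ≤ V` pointwise, the integral is maximal exactly when equality holds
almost everywhere, which is the characterization of optimal rules. Dirac measures turn "almost every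
state" into "every state". -/

/-! ### Measurable selection from compact-valued maps. -/

section Selection

variable {S U : Type*} [MeasurableSpace S] [TopologicalSpace U]

/-- The points of `A` at which `g` attains its minimum over `A`. -/
def argminOn (g : U → ℝ) (A : Set U) : Set U := {u ∈ A | ∀ v ∈ A, g u ≤ g v}

lemma argminOn_nonempty {g : U → ℝ} (hg : Continuous g) {A : Set U} (hA : IsCompact A)
    (hne : A.Nonempty) : (argminOn g A).Nonempty := by
  obtain ⟨u, hu, hmin⟩ := hA.exists_isMinOn hne hg.continuousOn
  exact ⟨u, hu, fun v hv => hmin hv⟩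

lemma isCompact_argminOn {g : U → ℝ} (hg : Continuous g) {A : Set U} (hA : IsCompact A) :
    IsCompact (argminOn g A) := by
  have : argminOn g A = A ∩ ⋂ v ∈ A, {u | g u ≤ g v} := by
    ext u; simp [argminOn]
  rw [this]
  exact hA.inter_right (isClosed_biInter fun v _ => isClosed_le hg continuous_const)

/-- A minimizer over `A s` lies in `F` exactly when `A s ∩ F` is nonempty and its minimum does not
exceed that over `A s`. Comparing the two minima at rational levels involves only hitting sets of
closed sets. -/
lemma measurableSet_argminOn_hits {g : U → ℝ} (hg : Continuous g) {A : S → Set U}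
    (hA : ∀ s, IsCompact (A s))
    (hm : ∀ F, IsClosed F → MeasurableSet {s | (A s ∩ F).Nonempty}) {F : Set U}
    (hF : IsClosed F) : MeasurableSet {s | (argminOn g (A s) ∩ F).Nonempty} := by
  have key : {s | (argminOn g (A s) ∩ F).Nonempty} =
      ({s | (A s ∩ F).Nonempty}) ∩ ⋂ c : ℚ, ({s | (A s ∩ {u | g u ≤ c}).Nonempty}ᶜ ∪
        {s | (A s ∩ (F ∩ {u | g u ≤ c})).Nonempty}) := by
    ext s
    simp only [mem_ofPred_eq, mem_inter_iff, mem_iInter, mem_union, mem_compl_iff]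
    constructor
    · rintro ⟨u, ⟨huA, hu⟩, huF⟩
      refine ⟨⟨u, huA, huF⟩, fun c => or_iff_not_imp_left.2 fun h => ?_⟩
      obtain ⟨v, hvA, hv⟩ := not_not.1 h
      exact ⟨u, huA, huF, (hu v hvA).trans hv⟩
    · rintro ⟨hAF, h⟩
      obtain ⟨u, ⟨huA, huF⟩, hu⟩ :=
        ((hA s).inter_right hF).exists_isMinOn hAF hg.continuousOn
      refine ⟨u, ⟨huA, fun v hv => ?_⟩, huF⟩
      by_contra! hlt
      obtain ⟨c, hc1, hc2⟩ := exists_rat_btwn hlt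
      rcases h c with h' | ⟨w, hwA, hwF, hw⟩
      · exact h' ⟨v, hv, hc1.le⟩
      · exact (hc2.trans_le (hu ⟨hwA, hwF⟩)).not_ge hw
  rw [key]
  have hcl (c : ℚ) : IsClosed {u | g u ≤ c} := isClosed_le hg continuous_const
  exact (hm F hF).inter (MeasurableSet.iInter fun c =>
    (hm _ (hcl c)).compl.union (hm _ (hF.inter (hcl c))))

/-- Measurable selection for compact-valued maps all of whose hitting sets of closed sets are
measurable. -/
theorem exists_measurable_selection [TopologicalSpace.MetrizableSpace U]
    [SecondCountableTopology U] [MeasurableSpace U] [BorelSpace U] {A : S → Set U}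
    (hA : ∀ s, IsCompact (A s)) (hne : ∀ s, (A s).Nonempty)
    (hm : ∀ F, IsClosed F → MeasurableSet {s | (A s ∩ F).Nonempty}) :
    ∃ f : S → U, Measurable f ∧ ∀ s, f s ∈ A s := by
  let _ := TopologicalSpace.metrizableSpaceMetric U
  -- Without a state, `U` could be empty and would have no dense sequence.
  rcases isEmpty_or_nonempty S with hS | ⟨⟨s₀⟩⟩
  · exact ⟨fun s => hS.elim s, measurable_of_empty _, fun s => hS.elim s⟩
  have : Nonempty U := (hne s₀).to_subtype.map Subtype.val
  let d := TopologicalSpace.denseSeq U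
  let g : ℕ → U → ℝ := fun n u => dist u (d n)
  have hg n : Continuous (g n) := continuous_id.dist continuous_const
  -- Successively minimizing the distance to each point of a dense sequence shrinks `A s` to a
  -- single point, while compactness and measurable hitting sets are preserved at each stage.
  let B : ℕ → S → Set U := fun n => Nat.rec A (fun n C s => argminOn (g n) (C s)) n
  have hB : ∀ n, (∀ s, IsCompact (B n s)) ∧ (∀ s, (B n s).Nonempty) ∧
      ∀ F, IsClosed F → MeasurableSet {s | (B n s ∩ F).Nonempty} := by
    intro n
    induction n with
    | zero => exact ⟨hA, hne, hm⟩
    | succ n ih =>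
      exact ⟨fun s => isCompact_argminOn (hg n) (ih.1 s),
        fun s => argminOn_nonempty (hg n) (ih.1 s) (ih.2.1 s),
        fun F hF => measurableSet_argminOn_hits (hg n) ih.1 ih.2.2 hF⟩
  have hsub n s : B (n + 1) s ⊆ B n s := fun u hu => hu.1
  have hint s (F : Set U) (hF : IsClosed F) (h : ∀ n, (B n s ∩ F).Nonempty) :
      (⋂ n, B n s ∩ F).Nonempty :=
    IsCompact.nonempty_iInter_of_sequence_nonempty_isCompact_isClosed _
      (fun n => inter_subset_inter_left _ (hsub n s)) h (((hB 0).1 s).inter_right hF)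
      fun n => ((hB n).1 s).isClosed.inter hF
  choose f hf using fun s => hint s univ isClosed_univ fun n => by simpa using (hB n).2.1 s
  have hfB s n : f s ∈ B n s := (mem_iInter.1 (hf s) n).1
  -- Two points in every `B n s` are equidistant from each point of a dense set, hence equal.
  have huniq s u (hu : ∀ n, u ∈ B n s) : u = f s := by
    have h n : dist u (d n) = dist (f s) (d n) :=
      le_antisymm ((hu (n + 1)).2 _ (hfB s n)) ((hfB s (n + 1)).2 _ (hu n))
    have h' : (fun x => dist u x) = fun x => dist (f s) x :=
      (TopologicalSpace.denseRange_denseSeq U).equalizer (continuous_const.dist continuous_id)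
        (continuous_const.dist continuous_id) (funext h)
    have := congrFun h' (f s)
    simpa using this
  refine ⟨f, measurable_of_isClosed fun F hF => ?_, fun s => hfB s 0⟩
  have : f ⁻¹' F = ⋂ n, {s | (B n s ∩ F).Nonempty} := by
    ext s
    simp only [mem_preimage, mem_iInter, mem_ofPred_eq]
    refine ⟨fun h n => ⟨f s, hfB s n, h⟩, fun h => ?_⟩
    obtain ⟨u, hu⟩ := hint s F hF h
    rw [← huniq s u fun n => (mem_iInter.1 hu n).1]
    exact (mem_iInter.1 hu 0).2
  rw [this]
  exact MeasurableSet.iInter fun n => (hB n).2.2 F hF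

end Selection

/-! ### The Bellman operator: fixed point and measurable maximizers. -/

namespace MDP

section Bellman

variable {S U : Type*} [MeasurableSpace S] [MeasurableSpace U] {M : MDP S U}

lemma exists_abs_r_le (h_above : BddAbove (range M.r)) (h_below : BddBelow (range M.r)) :
    ∃ C, ∀ k, |M.r k| ≤ C := by
  obtain ⟨a, ha⟩ := h_above
  obtain ⟨b, hb⟩ := h_below
  refine ⟨max |a| |b|, fun k => ?_⟩
  rw [abs_le, neg_le]
  have h1 := ha (mem_range_self k)
  have h2 := hb (mem_range_self k)
  exact ⟨(neg_le_neg h2).trans ((neg_le_abs b).trans (le_max_right _ _)),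
    h1.trans ((le_abs_self a).trans (le_max_left _ _))⟩

lemma abs_integral_le_of_abs_le {X : Type*} [MeasurableSpace X] {μ : Measure X}
    [IsProbabilityMeasure μ] {g : X → ℝ} {C : ℝ} (h : ∀ x, |g x| ≤ C) : |∫ x, g x ∂μ| ≤ C := by
  simpa using norm_integral_le_of_norm_le_const (μ := μ) (f := g) (.of_forall h)

lemma integrable_of_abs_le {X : Type*} [MeasurableSpace X] {μ : Measure X} [IsFiniteMeasure μ]
    {g : X → ℝ} (hg : Measurable g) {C : ℝ} (h : ∀ x, |g x| ≤ C) : Integrable g μ :=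
  Integrable.of_bound hg.aestronglyMeasurable C (.of_forall h)

lemma measurable_qValue {α : ℝ} {V : S → ℝ} (hV : Measurable V) : Measurable (M.qValue α V) :=
  M.measurable_r.add
    ((hV.stronglyMeasurable.integral_kernel (κ := M.Q)).measurable.const_mul α)

lemma abs_qValue_le {α : ℝ} (hα : 0 ≤ α) {V : S → ℝ} {C D : ℝ} (hr : ∀ k, |M.r k| ≤ C)
    (hV : ∀ s, |V s| ≤ D) (k : M.K) : |M.qValue α V k| ≤ C + α * D := by
  refine (abs_add_le _ _).trans (add_le_add (hr k) ?_)
  rw [abs_mul, abs_of_nonneg hα]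
  exact mul_le_mul_of_nonneg_left (abs_integral_le_of_abs_le hV) hα

lemma abs_qValue_sub_le {α : ℝ} (hα : 0 ≤ α) {V W : S → ℝ} (hVm : Measurable V)
    (hWm : Measurable W) {C C' D : ℝ} (hV : ∀ s, |V s| ≤ C) (hW : ∀ s, |W s| ≤ C')
    (hVW : ∀ s, |V s - W s| ≤ D) (k : M.K) :
    |M.qValue α V k - M.qValue α W k| ≤ α * D := by
  have : M.qValue α V k - M.qValue α W k = α * ∫ s, (V s - W s) ∂(M.Q k) := by
    rw [integral_sub (integrable_of_abs_le hVm hV) (integrable_of_abs_le hWm hW)]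
    simp only [qValue]; ring
  rw [this, abs_mul, abs_of_nonneg hα]
  exact mul_le_mul_of_nonneg_left (abs_integral_le_of_abs_le hVW) hα

variable [TopologicalSpace S] [TopologicalSpace U]

lemma upperSemicontinuous_qValue {α : ℝ} (h_usc : UpperSemicontinuous M.r)
    (h_Q : M.StronglyContinuous) {V : S → ℝ} (hV : Measurable V) (hb : ∃ C, ∀ s, |V s| ≤ C) :
    UpperSemicontinuous (M.qValue α V) :=
  h_usc.add (continuous_const.mul (h_Q V hV hb)).upperSemicontinuous

/-- Over a metrizable base, a continuous map with compact preimages of compact sets is proper.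
Properness gives both compact fibers, so that maxima are attained, and closed projections, so that
no analytic sets appear. -/
lemma isProperMap_state [TopologicalSpace.MetrizableSpace S]
    (h_cpt : ∀ C : Set S, IsCompact C → IsCompact {p : S × U | p.1 ∈ C ∧ p.2 ∈ M.feasible p.1}) :
    IsProperMap fun k : M.K => k.1.1 := by
  let _ := TopologicalSpace.metrizableSpaceMetric S
  refine isProperMap_iff_isCompact_preimage.2
    ⟨continuous_fst.comp continuous_subtype_val, fun C hC => ?_⟩
  rw [Topology.IsEmbedding.subtypeVal.isCompact_iff]
  convert h_cpt C hC using 1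
  ext p
  simp

lemma exists_isGreatest_fiber (hp : IsProperMap fun k : M.K => k.1.1) {q : M.K → ℝ}
    (hq : UpperSemicontinuous q) (s : S) :
    ∃ u : M.feasible s, IsGreatest (range fun u => q (M.pair s u)) (q (M.pair s u)) := by
  obtain ⟨u₀, hu₀⟩ := M.feasible_nonempty s
  obtain ⟨⟨⟨s', u⟩, hu⟩, hs, hmax⟩ := (hq.upperSemicontinuousOn _).exists_isMaxOn
    (s := (fun k : M.K => k.1.1) ⁻¹' {s}) ⟨M.pair s ⟨u₀, hu₀⟩, rfl⟩
    (hp.isCompact_preimage isCompact_singleton)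
  obtain rfl : s' = s := hs
  refine ⟨⟨u, hu⟩, mem_range_self _, ?_⟩
  rintro _ ⟨v, rfl⟩
  exact hmax (a := M.pair s' v) rfl

lemma isClosed_setOf_exists_le (hp : IsProperMap fun k : M.K => k.1.1) {q : M.K → ℝ}
    (hq : UpperSemicontinuous q) {F : Set U} (hF : IsClosed F) (c : ℝ) :
    IsClosed {s | ∃ u : M.feasible s, u.1 ∈ F ∧ c ≤ q (M.pair s u)} := by
  have hc : IsClosed {k : M.K | k.1.2 ∈ F ∧ c ≤ q k} :=
    (hF.preimage (continuous_snd.comp continuous_subtype_val)).inter (hq.isClosed_preimage c)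
  convert hp.isClosedMap _ hc using 1
  ext s
  constructor
  · rintro ⟨u, hu⟩
    exact ⟨M.pair s u, hu, rfl⟩
  · rintro ⟨⟨⟨s', u⟩, hu⟩, h, rfl⟩
    exact ⟨⟨u, hu⟩, h⟩

variable [BorelSpace S]

/-- Because the maximum is attained, a superlevel set of `W` is the projection of a superlevel set
of `q`, which is closed. -/
lemma measurable_of_isGreatest (hp : IsProperMap fun k : M.K => k.1.1) {q : M.K → ℝ}
    (hq : UpperSemicontinuous q) {W : S → ℝ}
    (hW : ∀ s, IsGreatest (range fun u => q (M.pair s u)) (W s)) : Measurable W := by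
  refine measurable_of_Ici fun c => ?_
  convert (isClosed_setOf_exists_le hp hq isClosed_univ c).measurableSet using 1
  ext s
  constructor
  · intro hc
    obtain ⟨u, hu⟩ := (hW s).1
    exact ⟨u, mem_univ _, hc.trans hu.ge⟩
  · rintro ⟨u, -, hu⟩
    exact hu.trans ((hW s).2 ⟨u, rfl⟩)

/-- The Bellman operator has a bounded measurable fixed point. -/
theorem exists_bellman_fixedPoint {α : ℝ} (hα0 : 0 ≤ α) (hα1 : α < 1)
    (h_usc : UpperSemicontinuous M.r) {C : ℝ} (hC : ∀ k, |M.r k| ≤ C)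
    (h_Q : M.StronglyContinuous) (hp : IsProperMap fun k : M.K => k.1.1) :
    ∃ V : S → ℝ, Measurable V ∧ (∃ D, ∀ s, |V s| ≤ D) ∧
      ∀ s, IsGreatest (range fun u => M.qValue α V (M.pair s u)) (V s) := by
  rcases isEmpty_or_nonempty S with hS | ⟨⟨s₀⟩⟩
  · exact ⟨fun _ => 0, measurable_const, ⟨0, fun s => hS.elim s⟩, fun s => hS.elim s⟩
  have hC0 : 0 ≤ C := by
    obtain ⟨u, hu⟩ := M.feasible_nonempty s₀
    exact (abs_nonneg _).trans (hC (M.pair s₀ ⟨u, hu⟩))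
  let T : (S → ℝ) → S → ℝ := fun V s => sSup (range fun u => M.qValue α V (M.pair s u))
  have hT {V : S → ℝ} (hV : Measurable V) (hb : ∃ D, ∀ s, |V s| ≤ D) (s : S) :
      IsGreatest (range fun u => M.qValue α V (M.pair s u)) (T V s) := by
    obtain ⟨u, hu⟩ := exists_isGreatest_fiber hp (upperSemicontinuous_qValue h_usc h_Q hV hb) s
    have h : T V s = M.qValue α V (M.pair s u) := hu.csSup_eq
    rwa [h]
  -- Contraction: test each function's maximizer in the other's maximum.
  have hTle {V W : S → ℝ} (hV : Measurable V) (hW : Measurable W) {D D' E : ℝ}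
      (hVb : ∀ s, |V s| ≤ D) (hWb : ∀ s, |W s| ≤ D') (hVW : ∀ s, |V s - W s| ≤ E) (s : S) :
      |T V s - T W s| ≤ α * E := by
    obtain ⟨u, hu⟩ := (hT hV ⟨D, hVb⟩ s).1
    obtain ⟨v, hv⟩ := (hT hW ⟨D', hWb⟩ s).1
    have h1 := (hT hV ⟨D, hVb⟩ s).2 ⟨v, rfl⟩
    have h2 := (hT hW ⟨D', hWb⟩ s).2 ⟨u, rfl⟩
    have h3 := abs_le.1 (abs_qValue_sub_le hα0 hV hW hVb hWb hVW (M.pair s u))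
    have h4 := abs_le.1 (abs_qValue_sub_le hα0 hV hW hVb hWb hVW (M.pair s v))
    simp only at hu hv h1 h2
    rw [abs_le]
    constructor <;> linarith
  -- The fixed point of `D ↦ C + α * D`, so the ball of radius `D` is invariant under `T`.
  let D := C / (1 - α)
  have hD : C + α * D = D := by
    have : 1 - α ≠ 0 := by linarith
    simp only [D]; field_simp; ring
  have hD0 : 0 ≤ D := div_nonneg hC0 (by linarith)
  have hTb {V : S → ℝ} (hV : Measurable V) (hb : ∀ s, |V s| ≤ D) (s : S) : |T V s| ≤ D := by
    obtain ⟨u, hu⟩ := (hT hV ⟨D, hb⟩ s).1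
    rw [← hu]
    exact (abs_qValue_le hα0 hC hb _).trans hD.le
  let W : ℕ → S → ℝ := fun n => T^[n] 0
  have hWs n : W (n + 1) = T (W n) := Function.iterate_succ_apply' T n 0
  have hW : ∀ n, Measurable (W n) ∧ ∀ s, |W n s| ≤ D := by
    intro n
    induction n with
    | zero => exact ⟨measurable_const, fun s => by simpa [W] using hD0⟩
    | succ n ih =>
      rw [hWs]
      exact ⟨measurable_of_isGreatest hp (upperSemicontinuous_qValue h_usc h_Q ih.1 ⟨D, ih.2⟩)
        (hT ih.1 ⟨D, ih.2⟩), hTb ih.1 ih.2⟩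
  have hstep : ∀ n s, dist (W n s) (W (n + 1) s) ≤ D * α ^ n := by
    intro n
    induction n with
    | zero => intro s; simpa [W, Real.dist_eq, abs_neg] using (hW 1).2 s
    | succ n ih =>
      intro s
      have := hTle (hW n).1 (hW (n + 1)).1 (hW n).2 (hW (n + 1)).2 ih s
      rw [← hWs, ← hWs] at this
      exact this.trans (by rw [pow_succ]; linarith)
  have hconv s : ∃ v, Filter.Tendsto (fun n => W n s) Filter.atTop (nhds v) :=
    cauchySeq_tendsto_of_complete (cauchySeq_of_le_geometric α D hα1 fun n => hstep n s)
  choose V hV using hconv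
  have hVm : Measurable V :=
    measurable_of_tendsto_metrizable (fun n => (hW n).1) (tendsto_pi_nhds.2 hV)
  have hVb s : |V s| ≤ D :=
    le_of_tendsto (hV s).abs (.of_forall fun n => (hW n).2 s)
  have hdist n s : |V s - W n s| ≤ D * α ^ n / (1 - α) := by
    rw [abs_sub_comm]
    exact dist_le_of_le_geometric_of_tendsto α D hα1 (fun n => hstep n s) (hV s) n
  -- `W (n + 1) s` tends to `V s` by construction, and to `T V s` by the contraction bound.
  have hfix : T V = V := by
    ext s
    refine tendsto_nhds_unique ?_ ((hV s).comp (Filter.tendsto_add_atTop_nat 1))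
    rw [tendsto_iff_dist_tendsto_zero]
    have hlim : Filter.Tendsto (fun n : ℕ => α * (D * α ^ n / (1 - α))) Filter.atTop (nhds 0) := by
      have := (((tendsto_pow_atTop_nhds_zero_of_lt_one hα0 hα1).const_mul D).div_const
        (1 - α)).const_mul α
      simpa using this
    refine squeeze_zero (fun _ => dist_nonneg) (fun n => ?_) hlim
    have := hTle hVm (hW n).1 hVb (hW n).2 (hdist n) s
    rw [← hWs, abs_sub_comm] at this
    exact this
  refine ⟨V, hVm, ⟨D, hVb⟩, fun s => ?_⟩
  have := hT hVm ⟨D, hVb⟩ s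
  rwa [hfix] at this

/-- Measurable selection of maximizers. -/
theorem exists_measurable_argmax [TopologicalSpace.MetrizableSpace U]
    [SecondCountableTopology U]
    [BorelSpace U] (hp : IsProperMap fun k : M.K => k.1.1) {q : M.K → ℝ}
    (hq : UpperSemicontinuous q) {V : S → ℝ}
    (hV : ∀ s, IsGreatest (range fun u => q (M.pair s u)) (V s)) :
    ∃ f : S → U, Measurable f ∧ ∀ s, ∃ hu : f s ∈ M.feasible s, V s ≤ q (M.pair s ⟨f s, hu⟩) := by
  have hVm := measurable_of_isGreatest hp hq hV
  refine exists_measurable_selection (A := fun s => {u | ∃ hu : u ∈ M.feasible s,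
    V s ≤ q (M.pair s ⟨u, hu⟩)}) (fun s => ?_) (fun s => ?_) fun F hF => ?_
  · have hK : IsCompact ((fun k : M.K => k.1.1) ⁻¹' {s} ∩ q ⁻¹' Ici (V s)) :=
      (hp.isCompact_preimage isCompact_singleton).inter_right (hq.isClosed_preimage _)
    convert hK.image (continuous_snd.comp continuous_subtype_val) using 1
    ext u
    constructor
    · rintro ⟨hu, h⟩
      exact ⟨M.pair s ⟨u, hu⟩, ⟨rfl, h⟩, rfl⟩
    · rintro ⟨⟨⟨s', u'⟩, hu⟩, ⟨hs, h⟩, rfl⟩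
      obtain rfl : s' = s := hs
      exact ⟨hu, h⟩
  · obtain ⟨u, hu⟩ := (hV s).1
    exact ⟨u, u.2, hu.ge⟩
  -- A maximizer lies in `F` iff the feasible actions in `F` reach every rational level below `V s`.
  -- The vacuous `-1 ≤ 0` casts nonemptiness of the feasible part of `F` as an instance of
  -- `isClosed_setOf_exists_le` with `q = 0`.
  · have key : {s | ({u | ∃ hu : u ∈ M.feasible s, V s ≤ q (M.pair s ⟨u, hu⟩)} ∩ F).Nonempty} =
        {s | ∃ u : M.feasible s, u.1 ∈ F ∧ -1 ≤ (0 : ℝ)} ∩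
          ⋂ c : ℚ, ({s | (c : ℝ) ≤ V s}ᶜ ∪
            {s | ∃ u : M.feasible s, u.1 ∈ F ∧ (c : ℝ) ≤ q (M.pair s u)}) := by
      ext s
      simp only [mem_ofPred_eq, mem_inter_iff, mem_iInter, mem_union, mem_compl_iff]
      constructor
      · rintro ⟨u, ⟨hu, h⟩, huF⟩
        exact ⟨⟨⟨u, hu⟩, huF, by norm_num⟩, fun c => or_iff_not_imp_left.2 fun hc =>
          ⟨⟨u, hu⟩, huF, (not_not.1 hc).trans h⟩⟩
      · rintro ⟨⟨u₀, hu₀, -⟩, h⟩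
        have hcl : IsClosed {k : M.K | k.1.2 ∈ F} :=
          hF.preimage (continuous_snd.comp continuous_subtype_val)
        obtain ⟨⟨⟨s', u⟩, hu⟩, ⟨hs, huF⟩, hmax⟩ := (hq.upperSemicontinuousOn _).exists_isMaxOn
          (s := (fun k : M.K => k.1.1) ⁻¹' {s} ∩ {k : M.K | k.1.2 ∈ F}) ⟨M.pair s u₀, rfl, hu₀⟩
          ((hp.isCompact_preimage isCompact_singleton).inter_right hcl)
        obtain rfl : s' = s := hs
        refine ⟨u, ⟨hu, ?_⟩, huF⟩
        by_contra! hlt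
        obtain ⟨c, hc1, hc2⟩ := exists_rat_btwn hlt
        rcases h c with h' | ⟨v, hvF, hv⟩
        · exact h' hc2.le
        · exact (hv.trans (hmax (a := M.pair s' v) ⟨rfl, hvF⟩)).not_gt hc1
    rw [key]
    refine (isClosed_setOf_exists_le hp (q := fun _ => (0 : ℝ)) upperSemicontinuous_const hF
      (-1)).measurableSet.inter (MeasurableSet.iInter fun c => ?_)
    exact (hVm measurableSet_Ici).compl.union (isClosed_setOf_exists_le hp hq hF c).measurableSet

end Bellman

end MDP

/-! ### Discounted rewards along flows of state-action laws. -/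

/-- Summing a discounted Bellman (in)equality along a path. -/
lemma tsum_discounted_of_bellman {α : ℝ} (hα0 : 0 ≤ α) (hα1 : α < 1) {r v q : ℕ → ℝ} {C D : ℝ}
    (hr : ∀ t, |r t| ≤ C) (hv : ∀ t, |v t| ≤ D) (hq : ∀ t, q t = r t + α * v (t + 1)) :
    ((∀ t, q t ≤ v t) → ∑' t, α ^ t * r t ≤ v 0) ∧
      ((∀ t, q t = v t) → ∑' t, α ^ t * r t = v 0) := by
  have hs {w : ℕ → ℝ} {E : ℝ} (hw : ∀ t, |w t| ≤ E) : Summable fun t => α ^ t * w t := by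
    refine Summable.of_norm_bounded
      ((summable_geometric_of_lt_one hα0 hα1).mul_right E) fun t => ?_
    rw [Real.norm_eq_abs, abs_mul, abs_of_nonneg (pow_nonneg hα0 t)]
    exact mul_le_mul_of_nonneg_left (hw t) (pow_nonneg hα0 t)
  have hsr := hs hr
  have hsv := hs hv
  have hsv' : Summable fun t => α ^ (t + 1) * v (t + 1) :=
    (summable_nat_add_iff (f := fun t => α ^ t * v t) 1).2 hsv
  have hsq : Summable fun t => α ^ t * q t := by
    refine (hsr.add hsv').congr fun t => ?_
    rw [hq, pow_succ]; ring
  -- Replacing `q` by `v` here leaves the series of `α ^ t * v t` minus its own tail, that is `v 0`.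
  have hsum : ∑' t, α ^ t * r t = ∑' t, α ^ t * q t - ∑' t, α ^ (t + 1) * v (t + 1) := by
    rw [← hsq.tsum_sub hsv']
    refine tsum_congr fun t => ?_
    rw [hq, pow_succ]; ring
  have hv0 : ∑' t, α ^ t * v t = v 0 + ∑' t, α ^ (t + 1) * v (t + 1) := by
    rw [hsv.tsum_eq_zero_add]; simp
  constructor
  · intro h
    have := hsq.tsum_le_tsum (fun t => mul_le_mul_of_nonneg_left (h t) (pow_nonneg hα0 t)) hsv
    linarith
  · intro h
    have : ∑' t, α ^ t * q t = ∑' t, α ^ t * v t := tsum_congr fun t => by rw [h]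
    linarith

namespace MDP

variable {S U : Type*} [MeasurableSpace S] [MeasurableSpace U] {M : MDP S U}

lemma measurable_state : Measurable fun k : M.K => k.1.1 :=
  measurable_fst.comp measurable_subtype_coe

/-- A sequence of laws of state-action pairs in which the law of each state is the one that the
transition kernel produces from the preceding pair. -/
structure IsFlow (M : MDP S U) (μ : ℕ → Measure M.K) : Prop where
  prob : ∀ t, IsProbabilityMeasure (μ t)
  map_state_succ : ∀ t, (μ (t + 1)).map (fun k => k.1.1) = (μ t).bind M.Q

lemma integral_bind_of_abs_le {X Y : Type*} [MeasurableSpace X] [MeasurableSpace Y]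
    {μ : Measure X} [IsProbabilityMeasure μ] (κ : Kernel X Y) [IsMarkovKernel κ] {g : Y → ℝ}
    (hg : Measurable g) {C : ℝ} (h : ∀ y, |g y| ≤ C) :
    ∫ y, g y ∂(μ.bind κ) = ∫ x, ∫ y, g y ∂(κ x) ∂μ := by
  rw [Measure.comp_eq_comp_const_apply, Kernel.integral_comp (integrable_of_abs_le hg h),
    Kernel.const_apply]

section Flow

variable {α : ℝ} (hα0 : 0 ≤ α) {C D : ℝ} (hC : ∀ k, |M.r k| ≤ C) {V : S → ℝ}
  (hVm : Measurable V) (hVb : ∀ s, |V s| ≤ D)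

include hC hVm hVb

lemma integral_qValue (μ : Measure M.K) [IsProbabilityMeasure μ] :
    ∫ k, M.qValue α V k ∂μ = ∫ k, M.r k ∂μ + α * ∫ s, V s ∂(μ.bind M.Q) := by
  rw [integral_bind_of_abs_le M.Q hVm hVb, ← integral_const_mul, ← integral_add]
  · rfl
  · exact integrable_of_abs_le M.measurable_r hC
  · exact (integrable_of_abs_le (hVm.stronglyMeasurable.integral_kernel (κ := M.Q)).measurable
      fun k => abs_integral_le_of_abs_le hVb).const_mul α

variable (hq : ∀ k, M.qValue α V k ≤ V k.1.1)

include hα0 hq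

lemma integral_qValue_le (μ : Measure M.K) [IsProbabilityMeasure μ] :
    ∫ k, M.qValue α V k ∂μ ≤ ∫ k, V k.1.1 ∂μ :=
  integral_mono (integrable_of_abs_le (measurable_qValue hVm) (abs_qValue_le hα0 hC hVb))
    (integrable_of_abs_le (hVm.comp measurable_state) fun k => hVb k.1.1) hq

lemma integral_qValue_eq_iff (μ : Measure M.K) [IsProbabilityMeasure μ] :
    ∫ k, M.qValue α V k ∂μ = ∫ k, V k.1.1 ∂μ ↔ ∀ᵐ k ∂μ, V k.1.1 ≤ M.qValue α V k := by
  refine (integral_eq_iff_of_ae_le (g := fun k : M.K => V k.1.1)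
    (integrable_of_abs_le (measurable_qValue hVm) (abs_qValue_le hα0 hC hVb))
    (integrable_of_abs_le (hVm.comp measurable_state) fun k => hVb k.1.1) (.of_forall hq)).trans ?_
  exact ⟨fun h => h.mono fun k hk => hk.ge, fun h => h.mono fun k hk => le_antisymm (hq k) hk⟩

/-- The flow property turns the integral of `V` against `Q` into the integral of `V` at the next
time, reducing the claim to a scalar recursion. It serves both the stochastic and the measurized
problem. -/
lemma IsFlow.tsum_reward (hα1 : α < 1) {μ : ℕ → Measure M.K} (hμ : M.IsFlow μ) :
    (∑' t, α ^ t * ∫ k, M.r k ∂(μ t) ≤ ∫ k, V k.1.1 ∂(μ 0)) ∧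
      ((∀ t, ∀ᵐ k ∂(μ t), V k.1.1 ≤ M.qValue α V k) →
        ∑' t, α ^ t * ∫ k, M.r k ∂(μ t) = ∫ k, V k.1.1 ∂(μ 0)) := by
  have := hμ.prob
  have hrec t : ∫ k, M.qValue α V k ∂(μ t) =
      ∫ k, M.r k ∂(μ t) + α * ∫ k, V k.1.1 ∂(μ (t + 1)) := by
    rw [integral_qValue hC hVm hVb, ← hμ.map_state_succ,
      integral_map measurable_state.aemeasurable hVm.aestronglyMeasurable]
  obtain ⟨h1, h2⟩ := tsum_discounted_of_bellman (v := fun t => ∫ k, V k.1.1 ∂(μ t)) hα0 hα1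
    (fun t => abs_integral_le_of_abs_le hC) (fun t => abs_integral_le_of_abs_le fun k => hVb k.1.1)
    hrec
  exact ⟨h1 fun t => integral_qValue_le hα0 hC hVm hVb hq _,
    fun h => h2 fun t => (integral_qValue_eq_iff hα0 hC hVm hVb hq _).2 (h t)⟩

end Flow

end MDP

/-! ### State-action laws under a policy. -/

namespace MDP

variable {S U : Type*} [MeasurableSpace S] [MeasurableSpace U] {M : MDP S U}

section PairKernel

variable {X : Type*} [MeasurableSpace X]

lemma pairKernel_apply' (σ : X → S) (hσ : Measurable σ) (κ : Kernel X U) [IsSFiniteKernel κ]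
    (x : X) {A : Set M.K} (hA : MeasurableSet A) :
    M.pairKernel σ hσ κ x A = κ x {u | ∃ hu : u ∈ M.feasible (σ x), M.pair (σ x) ⟨u, hu⟩ ∈ A} := by
  have he := MeasurableEmbedding.subtype_coe M.measurableSet_graph
  rw [pairKernel, Kernel.comapRight_apply' _ he _ hA, Kernel.prod_apply,
    Kernel.deterministic_apply, Measure.dirac_prod,
    Measure.map_apply measurable_prodMk_left (he.measurableSet_image' hA)]
  congr 1
  ext u
  constructor
  · rintro ⟨⟨⟨s, u'⟩, hu⟩, hk, h⟩
    obtain ⟨rfl, rfl⟩ := Prod.mk.inj h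
    exact ⟨hu, hk⟩
  · rintro ⟨hu, hk⟩
    exact ⟨_, hk, rfl⟩

lemma map_state_pairKernel (σ : X → S) (hσ : Measurable σ) (κ : Kernel X U) [IsMarkovKernel κ]
    (hκ : ∀ x, κ x (M.feasible (σ x)) = 1) (x : X) :
    (M.pairKernel σ hσ κ x).map (fun k => k.1.1) = Measure.dirac (σ x) := by
  ext B hB
  rw [Measure.map_apply measurable_state hB, pairKernel_apply' _ _ _ _ (measurable_state hB),
    Measure.dirac_apply' _ hB]
  by_cases h : σ x ∈ B
  · rw [indicator_of_mem h, Pi.one_apply, ← hκ x]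
    congr 1
    ext u
    exact ⟨fun ⟨hu, _⟩ => hu, fun hu => ⟨hu, h⟩⟩
  · rw [indicator_of_notMem h]
    convert measure_empty (μ := κ x)
    exact eq_empty_of_forall_notMem fun u ⟨_, hu⟩ => h hu

lemma map_state_bind_pairKernel (μ : Measure X) (σ : X → S) (hσ : Measurable σ) (κ : Kernel X U)
    [IsMarkovKernel κ] (hκ : ∀ x, κ x (M.feasible (σ x)) = 1) :
    (μ.bind (M.pairKernel σ hσ κ)).map (fun k => k.1.1) = μ.map σ := by
  rw [Measure.map_comp _ _ measurable_state, ← Measure.deterministic_comp_eq_map hσ]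
  congr 1
  ext x : 1
  rw [Kernel.map_apply _ measurable_state, map_state_pairKernel _ _ _ hκ,
    Kernel.deterministic_apply]

end PairKernel

/-- The law of `(s_t, u_t)` under a policy. -/
noncomputable def Policy.marginal (π : M.Policy) (ν : Measure S) (t : ℕ) : Measure M.K :=
  (π.law ν).map fun ω => ω t

instance (π : M.Policy) (ν : Measure S) [IsProbabilityMeasure ν] :
    IsProbabilityMeasure (π.initialLaw ν) := by
  unfold Policy.initialLaw
  have : IsProbabilityMeasure (ν.map fun s => ((fun i => i.elim0 : Fin 0 → M.K), s)) :=
    Measure.isProbabilityMeasure_map (by fun_prop)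
  infer_instance

instance (π : M.Policy) (ν : Measure S) [IsProbabilityMeasure ν] :
    IsProbabilityMeasure (π.law ν) := by
  unfold Policy.law; infer_instance

instance (π : M.Policy) (ν : Measure S) [IsProbabilityMeasure ν] (t : ℕ) :
    IsProbabilityMeasure (π.marginal ν t) :=
  Measure.isProbabilityMeasure_map (measurable_pi_apply t).aemeasurable

lemma Policy.marginal_zero (π : M.Policy) (ν : Measure S) [IsProbabilityMeasure ν] :
    π.marginal ν 0 = π.initialLaw ν := by
  -- A history indexed by `Finset.Iic 0` is a single pair, so `piUnique` undoes the identification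
  -- built into `trajMeasure`.
  have h : (fun ω : ℕ → M.K => ω 0) = (MeasurableEquiv.piUnique fun _ : Finset.Iic 0 => M.K) ∘
      Preorder.frestrictLe 0 := rfl
  rw [marginal, law, Kernel.trajMeasure, h, ← Measure.map_map (by fun_prop) (by fun_prop),
    Measure.map_comp _ _ (by fun_prop), Kernel.traj_map_frestrictLe, Kernel.partialTraj_self,
    Measure.id_comp, Measure.map_map (by fun_prop) (by fun_prop)]
  convert Measure.map_id
  exact funext fun x => MeasurableEquiv.apply_symm_apply _ x

lemma Policy.marginal_succ (π : M.Policy) (ν : Measure S) [IsProbabilityMeasure ν] (t : ℕ) :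
    π.marginal ν (t + 1) =
      (((π.law ν).map (Preorder.frestrictLe t)).bind (M.historyStep t)).bind
        (π.pairLaw (t + 1)) := by
  have h := congrArg Measure.snd (Kernel.map_frestrictLe_trajMeasure_compProd_eq_map_trajMeasure
    (X := fun _ => M.K) (κ := π.step) (μ₀ := π.initialLaw ν) (a := t))
  have : IsProbabilityMeasure ((π.law ν).map (Preorder.frestrictLe (π := fun _ => M.K) t)) :=
    Measure.isProbabilityMeasure_map (by fun_prop)
  rw [Measure.snd_compProd, Measure.snd_map_prodMk (by fun_prop)] at h
  rw [Measure.comp_assoc]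
  exact h.symm

lemma map_snd_historyStep (t : ℕ) (h : (i : Finset.Iic t) → M.K) :
    (M.historyStep t h).map Prod.snd = M.Q (h ⟨t, Finset.mem_Iic.2 le_rfl⟩) := by
  rw [← Kernel.map_apply _ measurable_snd, ← Kernel.snd_eq, historyStep, Kernel.snd_prod,
    Kernel.comap_apply]

/-- Drawing an action does not change the state, and the state component of `historyStep` depends
only on the last pair. History dependence of the policy is therefore invisible here. -/
lemma Policy.isFlow_marginal (π : M.Policy) (ν : Measure S) [IsProbabilityMeasure ν] :
    M.IsFlow (π.marginal ν) where
  prob _ := inferInstance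
  map_state_succ t := by
    have := π.markov (t + 1)
    rw [π.marginal_succ, pairLaw, map_state_bind_pairKernel _ _ _ _ (π.feasible (t + 1)),
      Measure.map_comp _ _ measurable_snd, marginal]
    have h2 : (fun ω : ℕ → M.K => ω t) =
        (fun h : (i : Finset.Iic t) → M.K => h ⟨t, Finset.mem_Iic.2 le_rfl⟩) ∘
          Preorder.frestrictLe t := rfl
    rw [h2, ← Measure.map_map (by fun_prop) (by fun_prop),
      ← Measure.deterministic_comp_eq_map (measurable_pi_apply _), Measure.comp_assoc]
    congr 1
    ext h : 1
    rw [Kernel.map_apply _ measurable_snd, map_snd_historyStep, Kernel.comp_deterministic_eq_comap,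
      Kernel.comap_apply]

lemma Policy.map_state_marginal_zero (π : M.Policy) (ν : Measure S) [IsProbabilityMeasure ν] :
    (π.marginal ν 0).map (fun k => k.1.1) = ν := by
  have := π.markov 0
  rw [π.marginal_zero, initialLaw, pairLaw, map_state_bind_pairKernel _ _ _ _ (π.feasible 0),
    Measure.map_map measurable_snd (by fun_prop)]
  exact Measure.map_id

lemma Policy.value_eq_tsum (π : M.Policy) {α : ℝ} (hα0 : 0 ≤ α) (hα1 : α < 1) {C : ℝ}
    (hC : ∀ k, |M.r k| ≤ C) (s : S) :
    π.value α s = ∑' t, α ^ t * ∫ k, M.r k ∂(π.marginal (Measure.dirac s) t) := by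
  have hm t : Measurable fun ω : ℕ → M.K => α ^ t * M.r (ω t) :=
    (M.measurable_r.comp (measurable_pi_apply t)).const_mul _
  have hb t (ω : ℕ → M.K) : |α ^ t * M.r (ω t)| ≤ α ^ t * C := by
    rw [abs_mul, abs_of_nonneg (pow_nonneg hα0 t)]
    exact mul_le_mul_of_nonneg_left (hC _) (pow_nonneg hα0 t)
  have hint t : Integrable (fun ω : ℕ → M.K => α ^ t * M.r (ω t)) (π.law (Measure.dirac s)) :=
    integrable_of_abs_le (hm t) (hb t)
  unfold value totalReward
  rw [← integral_tsum_of_summable_integral_norm hint]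
  · refine tsum_congr fun t => ?_
    rw [integral_const_mul, marginal, integral_map (measurable_pi_apply t).aemeasurable
      M.measurable_r.aestronglyMeasurable]
  · refine Summable.of_nonneg_of_le (fun t => integral_nonneg fun ω => norm_nonneg _) (fun t => ?_)
      ((summable_geometric_of_lt_one hα0 hα1).mul_right C)
    have := integral_mono (μ := π.law (Measure.dirac s)) (hint t).norm (integrable_const (α ^ t * C))
      (hb t)
    simpa using this

/-- The stationary policy of a decision rule. -/
noncomputable def DecisionRule.policy (φ : M.DecisionRule) : M.Policy where
  toKernel _ := φ.toKernel.comap Prod.snd measurable_snd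
  markov _ := have := φ.markov; inferInstance
  feasible _ h := φ.feasible h.2

lemma DecisionRule.policy_pairLaw (φ : M.DecisionRule) (t : ℕ) (h : (Fin t → M.K) × S) :
    φ.policy.pairLaw t h = φ.pairLaw h.2 := by
  have := φ.markov
  have := φ.policy.markov t
  ext A hA
  rw [Policy.pairLaw, DecisionRule.pairLaw, pairKernel_apply' _ _ _ _ hA,
    pairKernel_apply' _ _ _ _ hA]
  rfl

/-- At every time the last step of the construction draws the pair from `φ.pairLaw` at the current
state, so a case split replaces induction. -/
lemma DecisionRule.ae_marginal_policy (φ : M.DecisionRule) (ν : Measure S)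
    [IsProbabilityMeasure ν] {p : M.K → Prop} (hp : MeasurableSet {k | p k})
    (h : ∀ s, ∀ᵐ k ∂(φ.pairLaw s), p k) (t : ℕ) : ∀ᵐ k ∂(φ.policy.marginal ν t), p k := by
  cases t with
  | zero =>
    rw [Policy.marginal_zero, Policy.initialLaw, Measure.ae_comp_iff hp]
    exact .of_forall fun x => by rw [policy_pairLaw]; exact h _
  | succ t =>
    rw [Policy.marginal_succ, Measure.ae_comp_iff hp]
    exact .of_forall fun x => by rw [policy_pairLaw]; exact h _

/-- The decision rule that always chooses the action of a selector. -/
noncomputable def IsSelector.rule {f : S → U} (hf : M.IsSelector f) : M.DecisionRule where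
  toKernel := Kernel.deterministic f hf.1
  markov := inferInstance
  feasible s := by
    have hm : MeasurableSet (M.feasible s) := measurable_prodMk_left M.measurableSet_graph
    rw [Kernel.deterministic_apply' _ _ hm, indicator_of_mem (hf.2 s)]

end MDP

/-! ### The measurized flow, and consequences of a Bellman solution. -/

namespace MDP

variable {S U : Type*} [MeasurableSpace S] [MeasurableSpace U] {M : MDP S U}

/-- The law of the state-action pair when the state has law `ν` and the action is drawn from the
decision rule `φ`. -/
noncomputable def DecisionRule.jointLaw (φ : M.DecisionRule) (ν : Measure S) : Measure M.K :=
  ν.bind φ.pairLaw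

instance (φ : M.DecisionRule) (ν : Measure S) [IsProbabilityMeasure ν] :
    IsProbabilityMeasure (φ.jointLaw ν) := by
  unfold DecisionRule.jointLaw; infer_instance

lemma DecisionRule.map_state_jointLaw (φ : M.DecisionRule) (ν : Measure S) :
    (φ.jointLaw ν).map (fun k => k.1.1) = ν := by
  have := φ.markov
  rw [jointLaw, pairLaw, map_state_bind_pairKernel _ id _ _ φ.feasible]
  exact Measure.map_id

lemma coe_liftedStep (ν : ProbabilityMeasure S) (φ : M.DecisionRule) :
    (M.liftedStep ν φ : Measure S) = (φ.jointLaw ν).bind M.Q :=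
  Measure.comp_assoc.symm

lemma isFlow_lifted (ν : ProbabilityMeasure S) (φ : ℕ → M.DecisionRule) :
    M.IsFlow fun t => (φ t).jointLaw (M.liftedPath ν φ t) where
  prob _ := inferInstance
  map_state_succ t := by
    rw [DecisionRule.map_state_jointLaw, liftedPath, coe_liftedStep]

lemma liftedReward_eq {C : ℝ} (hC : ∀ k, |M.r k| ≤ C) (ν : ProbabilityMeasure S)
    (φ : M.DecisionRule) : M.liftedReward ν φ = ∫ k, M.r k ∂(φ.jointLaw ν) :=
  (integral_bind_of_abs_le _ M.measurable_r hC).symm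

/-- A bounded measurable function that satisfies the optimality equation with the supremum
attained in every state. -/
structure IsBellmanSolution (M : MDP S U) (α : ℝ) (V : S → ℝ) : Prop where
  measurable : Measurable V
  bounded : ∃ D, ∀ s, |V s| ≤ D
  isGreatest : ∀ s, IsGreatest (range fun u => M.qValue α V (M.pair s u)) (V s)

namespace IsBellmanSolution

variable {α : ℝ} {V : S → ℝ} (hV : M.IsBellmanSolution α V)

include hV

lemma qValue_le (k : M.K) : M.qValue α V k ≤ V k.1.1 :=
  (hV.isGreatest k.1.1).2 ⟨⟨k.1.2, k.2⟩, rfl⟩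

lemma mem_maximizers_iff {s : S} {u : U} : u ∈ M.maximizers α V s ↔
    ∃ hu : u ∈ M.feasible s, V s ≤ M.qValue α V (M.pair s ⟨u, hu⟩) := by
  refine exists_congr fun hu => ⟨fun h => ?_, fun h u' => ?_⟩
  · obtain ⟨u', hu'⟩ := (hV.isGreatest s).1
    exact hu'.ge.trans (h u')
  · exact (hV.qValue_le (M.pair s u')).trans h

lemma measurableSet_le_qValue : MeasurableSet {k : M.K | V k.1.1 ≤ M.qValue α V k} :=
  measurableSet_le (hV.measurable.comp measurable_state) (measurable_qValue hV.measurable)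

/-- The set of maximizers is the section at `s` of the measurable set of pairs where `V ≤ qValue`.
-/
lemma pairLaw_ae_iff (φ : M.DecisionRule) (s : S) :
    (∀ᵐ k ∂(φ.pairLaw s), V k.1.1 ≤ M.qValue α V k) ↔
      φ.toKernel s (M.maximizers α V s) = 1 := by
  have := φ.markov
  have hset : {u | ∃ hu : u ∈ M.feasible s,
      M.pair s ⟨u, hu⟩ ∈ {k : M.K | V k.1.1 ≤ M.qValue α V k}} = M.maximizers α V s := by
    ext u
    exact hV.mem_maximizers_iff.symm
  rw [← hset]
  refine Iff.trans (mem_ae_iff_prob_eq_one hV.measurableSet_le_qValue) ?_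
  rw [DecisionRule.pairLaw, pairKernel_apply' _ _ _ _ hV.measurableSet_le_qValue]
  rfl

lemma jointLaw_ae_iff (φ : M.DecisionRule) (ν : Measure S) :
    (∀ᵐ k ∂(φ.jointLaw ν), V k.1.1 ≤ M.qValue α V k) ↔
      ∀ᵐ s ∂ν, φ.toKernel s (M.maximizers α V s) = 1 := by
  rw [DecisionRule.jointLaw, Measure.ae_comp_iff hV.measurableSet_le_qValue]
  exact Filter.eventually_congr (.of_forall fun s => hV.pairLaw_ae_iff φ s)

variable (hα0 : 0 ≤ α) {C : ℝ} (hC : ∀ k, |M.r k| ≤ C)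

include hα0 hC

section Value

variable (hα1 : α < 1) {φ₀ : M.DecisionRule}
  (hφ₀ : ∀ s, φ₀.toKernel s (M.maximizers α V s) = 1)

include hα1 hφ₀

/-- Every policy induces a flow with initial state law `dirac s`, so `V s` bounds all values; the
stationary policy of `φ₀` attains it. -/
theorem optValue_eq : M.optValue α = V := by
  obtain ⟨D, hD⟩ := hV.bounded
  ext s
  have hend (π : M.Policy) : ∫ k, V k.1.1 ∂(π.marginal (Measure.dirac s) 0) = V s := by
    rw [← integral_map (f := V) measurable_state.aemeasurable hV.measurable.aestronglyMeasurable,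
      π.map_state_marginal_zero, integral_dirac' _ _ hV.measurable.stronglyMeasurable]
  have hle (π : M.Policy) : π.value α s ≤ V s := by
    rw [π.value_eq_tsum hα0 hα1 hC, ← hend π]
    exact ((π.isFlow_marginal _).tsum_reward hα0 hC hV.measurable hD hV.qValue_le hα1).1
  have heq : φ₀.policy.value α s = V s := by
    rw [Policy.value_eq_tsum _ hα0 hα1 hC, ← hend φ₀.policy]
    exact ((Policy.isFlow_marginal _ _).tsum_reward hα0 hC hV.measurable hD hV.qValue_le hα1).2
      (φ₀.ae_marginal_policy _ hV.measurableSet_le_qValue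
        fun s => (hV.pairLaw_ae_iff φ₀ s).2 (hφ₀ s))
  have : Nonempty M.Policy := ⟨φ₀.policy⟩
  refine le_antisymm (ciSup_le hle)
    (heq.ge.trans (le_ciSup (f := fun π : M.Policy => π.value α s) ?_ φ₀.policy))
  exact ⟨V s, by rintro _ ⟨π, rfl⟩; exact hle π⟩

theorem liftedOptValue_eq (ν : ProbabilityMeasure S) :
    M.liftedOptValue α ν = ∫ s, V s ∂(ν : Measure S) := by
  obtain ⟨D, hD⟩ := hV.bounded
  have hend (φ : ℕ → M.DecisionRule) :
      ∫ k, V k.1.1 ∂((φ 0).jointLaw (M.liftedPath ν φ 0)) = ∫ s, V s ∂(ν : Measure S) := by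
    rw [← integral_map (f := V) measurable_state.aemeasurable hV.measurable.aestronglyMeasurable,
      DecisionRule.map_state_jointLaw, liftedPath]
  have hflow (φ : ℕ → M.DecisionRule) :=
    (isFlow_lifted ν φ).tsum_reward hα0 hC hV.measurable hD hV.qValue_le hα1
  simp only [hend, ← liftedReward_eq hC] at hflow
  have : Nonempty (ℕ → M.DecisionRule) := ⟨fun _ => φ₀⟩
  refine le_antisymm (ciSup_le fun φ => (hflow φ).1) ?_
  rw [← (hflow fun _ => φ₀).2 fun t => (hV.jointLaw_ae_iff φ₀ _).2 (.of_forall hφ₀)]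
  refine le_ciSup (f := fun φ : ℕ → M.DecisionRule =>
    ∑' t, α ^ t * M.liftedReward (M.liftedPath ν φ t) (φ t)) ?_ fun _ => φ₀
  -- `le_ciSup` needs boundedness above; the flow inequality supplies it.
  exact ⟨∫ s, V s ∂(ν : Measure S), by rintro _ ⟨φ, rfl⟩; exact (hflow φ).1⟩

lemma liftedQValue_eq (ν : ProbabilityMeasure S) (φ : M.DecisionRule) :
    M.liftedQValue α (M.liftedOptValue α) ν φ = ∫ k, M.qValue α V k ∂(φ.jointLaw ν) := by
  obtain ⟨D, hD⟩ := hV.bounded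
  rw [liftedQValue, hV.liftedOptValue_eq hα0 hC hα1 hφ₀, liftedReward_eq hC, coe_liftedStep,
    integral_qValue hC hV.measurable hD]

lemma liftedQValue_le (ν : ProbabilityMeasure S) (φ : M.DecisionRule) :
    M.liftedQValue α (M.liftedOptValue α) ν φ ≤ M.liftedOptValue α ν := by
  obtain ⟨D, hD⟩ := hV.bounded
  rw [hV.liftedQValue_eq hα0 hC hα1 hφ₀, hV.liftedOptValue_eq hα0 hC hα1 hφ₀]
  -- Only the `ν` on the right is rewritten, so that both integrals are over `φ.jointLaw ν`.
  nth_rw 2 [← φ.map_state_jointLaw (ν : Measure S)]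
  rw [integral_map measurable_state.aemeasurable hV.measurable.aestronglyMeasurable]
  exact integral_qValue_le hα0 hC hV.measurable hD hV.qValue_le _

lemma liftedQValue_eq_liftedOptValue_iff (ν : ProbabilityMeasure S) (φ : M.DecisionRule) :
    M.liftedQValue α (M.liftedOptValue α) ν φ = M.liftedOptValue α ν ↔
      ∀ᵐ s ∂(ν : Measure S), φ.toKernel s (M.maximizers α V s) = 1 := by
  obtain ⟨D, hD⟩ := hV.bounded
  rw [← hV.jointLaw_ae_iff, ← integral_qValue_eq_iff hα0 hC hV.measurable hD hV.qValue_le,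
    hV.liftedQValue_eq hα0 hC hα1 hφ₀, hV.liftedOptValue_eq hα0 hC hα1 hφ₀,
    ← integral_map (f := V) measurable_state.aemeasurable hV.measurable.aestronglyMeasurable,
    φ.map_state_jointLaw]

theorem solvesLiftedDCOE : M.SolvesLiftedDCOE α (M.liftedOptValue α) := by
  intro ν
  refine IsGreatest.isLUB ⟨⟨φ₀, ?_⟩, ?_⟩
  · exact (hV.liftedQValue_eq_liftedOptValue_iff hα0 hC hα1 hφ₀ ν φ₀).2 (.of_forall hφ₀)
  · rintro _ ⟨φ, rfl⟩
    exact hV.liftedQValue_le hα0 hC hα1 hφ₀ ν φ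

theorem isOptimalRuleAt_iff (ν : ProbabilityMeasure S) (φ : M.DecisionRule) :
    M.IsOptimalRuleAt α ν φ ↔
      ∀ᵐ s ∂(ν : Measure S), φ.toKernel s (M.maximizers α V s) = 1 := by
  rw [← hV.liftedQValue_eq_liftedOptValue_iff hα0 hC hα1 hφ₀]
  refine ⟨fun h => le_antisymm (hV.liftedQValue_le hα0 hC hα1 hφ₀ ν φ) ?_, fun h φ' => ?_⟩
  · rw [← (hV.liftedQValue_eq_liftedOptValue_iff hα0 hC hα1 hφ₀ ν φ₀).2 (.of_forall hφ₀)]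
    exact h φ₀
  · rw [h]
    exact hV.liftedQValue_le hα0 hC hα1 hφ₀ ν φ'

theorem forall_isOptimalRuleAt_iff [MeasurableSingletonClass S] (φ : M.DecisionRule) :
    (∀ ν, M.IsOptimalRuleAt α ν φ) ↔ ∀ s, φ.toKernel s (M.maximizers α V s) = 1 := by
  simp only [hV.isOptimalRuleAt_iff hα0 hC hα1 hφ₀]
  refine ⟨fun h s => ?_, fun h ν => .of_forall h⟩
  -- With measurable singletons, almost everywhere for a Dirac measure means at its point.
  have := h ⟨Measure.dirac s, inferInstance⟩
  rwa [ProbabilityMeasure.coe_mk, ae_dirac_eq] at this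

end Value

end IsBellmanSolution

lemma IsSelector.rule_apply_eq_one {f : S → U} (hf : M.IsSelector f) {s : S} {A : Set U}
    (h : f s ∈ A) : hf.rule.toKernel s A = 1 := by
  change Kernel.deterministic f hf.1 s A = 1
  rw [Kernel.deterministic_apply]
  exact Measure.dirac_apply_of_mem h

/-- Changing `f` at the one state `s` to any other maximizer keeps it measurable and optimal, so
uniqueness excludes other maximizers. -/
lemma IsOptimalSelector.maximizers_eq_of_unique [MeasurableSingletonClass S] {α : ℝ} {f : S → U}
    (hf : M.IsOptimalSelector α f) (huniq : ∀ f', M.IsOptimalSelector α f' → f' = f) (s : S) :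
    M.maximizers α (M.optValue α) s = {f s} := by
  classical
  refine Subset.antisymm (fun u hu => ?_) (singleton_subset_iff.2 (hf.2 s))
  have hmax s' : Function.update f s u s' ∈ M.maximizers α (M.optValue α) s' := by
    rcases eq_or_ne s' s with rfl | h
    · rwa [Function.update_self]
    · rw [Function.update_of_ne h]; exact hf.2 s'
  have hmeas : Measurable (Function.update f s u) := by
    have : Function.update f s u = fun s' => if s' = s then u else f s' :=
      funext fun s' => Function.update_apply f s u s'
    rw [this]
    exact Measurable.ite (measurableSet_singleton s) measurable_const hf.1.1
  have h := huniq (Function.update f s u)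
    ⟨⟨hmeas, fun s' => (hmax s').1⟩, hmax⟩
  simpa using congrFun h s

end MDP

theorem theorem5p2 {S U : Type*}
    [TopologicalSpace S] [TopologicalSpace.MetrizableSpace S] [SecondCountableTopology S]
    [MeasurableSpace S] [BorelSpace S] [StandardBorelSpace S]
    [TopologicalSpace U] [TopologicalSpace.MetrizableSpace U] [SecondCountableTopology U]
    [MeasurableSpace U] [BorelSpace U] [StandardBorelSpace U]
    (M : MDP S U) (α : ℝ) (hα0 : 0 ≤ α) (hα1 : α < 1)
    -- the reward is upper semicontinuous, bounded above and sup-compact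
    (h_usc : UpperSemicontinuous M.r)
    (h_above : BddAbove (Set.range M.r))
    (h_sup : M.SupCompact)
    -- the transition law is strongly continuous
    (h_Q : M.StronglyContinuous)
    -- some policy has a finite value from every initial state
    (h_fin : ∃ π : M.Policy, ∀ s, Integrable (M.totalReward α) (π.law (Measure.dirac s)))
    -- the reward is bounded below
    (h_below : BddBelow (Set.range M.r))
    -- the feasible pairs over a compact set of states form a compact set
    (h_cpt : ∀ C : Set S, IsCompact C →
      IsCompact {p : S × U | p.1 ∈ C ∧ p.2 ∈ M.feasible p.1}) :
    -- the two value functions solve their optimality equations, and optimal selectors exist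
    M.SolvesDCOE α (M.optValue α) ∧
    M.SolvesLiftedDCOE α (M.liftedOptValue α) ∧
    (∃ f, M.IsOptimalSelector α f) ∧
    -- the Dirac kernel at any optimal selector attains the maximum at every `ν`
    (∀ f, M.IsOptimalSelector α f →
      ∃ φ : M.DecisionRule, (∀ s, φ.toKernel s {f s} = 1) ∧ ∀ ν, M.IsOptimalRuleAt α ν φ) ∧
    -- optimality at `ν` means concentration on optimal actions, for `ν`-almost every state
    (∀ (ν : ProbabilityMeasure S) (φ : M.DecisionRule), M.IsOptimalRuleAt α ν φ ↔
      ∀ᵐ s ∂(ν : Measure S), φ.toKernel s (M.maximizers α (M.optValue α) s) = 1) ∧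
    -- optimality at every `ν` means concentration on optimal actions, for every state
    (∀ φ : M.DecisionRule, (∀ ν, M.IsOptimalRuleAt α ν φ) ↔
      ∀ s, φ.toKernel s (M.maximizers α (M.optValue α) s) = 1) ∧
    -- if the optimal selector is unique, the rule optimal at every `ν` is its Dirac kernel
    (∀ f, M.IsOptimalSelector α f → (∀ f', M.IsOptimalSelector α f' → f' = f) →
      ∀ φ : M.DecisionRule, (∀ ν, M.IsOptimalRuleAt α ν φ) → ∀ s, φ.toKernel s {f s} = 1) := by
  obtain ⟨C, hC⟩ := MDP.exists_abs_r_le h_above h_below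
  have hp := MDP.isProperMap_state h_cpt
  obtain ⟨V, hVm, hVb, hVg⟩ := MDP.exists_bellman_fixedPoint hα0 hα1 h_usc hC h_Q hp
  have hV : M.IsBellmanSolution α V := ⟨hVm, hVb, hVg⟩
  obtain ⟨f, hfm, hf⟩ := MDP.exists_measurable_argmax hp
    (MDP.upperSemicontinuous_qValue h_usc h_Q hVm hVb) hVg
  have hfV s : f s ∈ M.maximizers α V s := hV.mem_maximizers_iff.2 (hf s)
  have hsel : M.IsSelector f := ⟨hfm, fun s => (hfV s).1⟩
  have hφ₀ s : hsel.rule.toKernel s (M.maximizers α V s) = 1 := hsel.rule_apply_eq_one (hfV s)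
  have hopt : M.optValue α = V := hV.optValue_eq hα0 hC hα1 hφ₀
  have hall := hV.forall_isOptimalRuleAt_iff hα0 hC hα1 hφ₀
  refine ⟨?_, hV.solvesLiftedDCOE hα0 hC hα1 hφ₀, ⟨f, hsel, ?_⟩, fun g hg => ?_, ?_, ?_, ?_⟩
  · rw [hopt]
    exact fun s => (hVg s).isLUB
  · rwa [hopt]
  · refine ⟨hg.1.rule, fun s => hg.1.rule_apply_eq_one rfl, (hall _).2 fun s => ?_⟩
    exact hg.1.rule_apply_eq_one (hopt ▸ hg.2 s)
  · rw [hopt]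
    exact hV.isOptimalRuleAt_iff hα0 hC hα1 hφ₀
  · rwa [hopt]
  · intro g hg huniq φ hφ s
    rw [← hg.maximizers_eq_of_unique huniq s, hopt]
    exact (hall φ).1 hφ s
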